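/- Let $\mathbb{S}^n\subset\mathbb{R}^{n+1}$ be the unit sphere and let $M$ be a non-empty smooth ($C^\infty$) submanifold of dimension $m$ of $\mathbb{S}^n$ (embedded or merely immersed), with inclusion $i:M\to\mathbb{S}^n$ and with the induced metric. Let $B$ be the second fundamental form of $M$ in $\mathbb{S}^n$, $H=\frac1m\operatorname{tr}B$ the mean curvature, $A$ the Weingarten operator and $\nabla^N$ the normal connection, so that $\nabla_X\xi=\nabla^N_X\xi-A_\xi X$ for $\xi$ normal and $X$ tangent to $M$. Suppose that $M$ is pseudo-umbilical, i.e. $A_H=|H|^2\,\mathrm{Id}_{TM}$, that $H$ is parallel, i.e. $\nabla^N H=0$, and that $|H|$ is a non-zero constant on $M$. For a smooth map $\varphi:(M,g)\to(N,h)$ of Riemannian manifolds put $\delta T\varphi=-\operatorname{tr}_g\nabla T\varphi$; $\varphi$ is harmonic if $\delta T\varphi=0$. For $k\in\mathbb{R}$ it is biharmonic of index $k$ if $$\Delta\,\delta T\varphi-\operatorname{tr}_g R^h(\delta T\varphi,T\varphi)T\varphi+k\,\delta T\varphi=0,$$ where $\Delta=-\operatorname{tr}_g\nabla^2$ on sections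 of $\varphi^*TN$ and $R^h(X,Y)=\nabla_X\nabla_Y-\nabla_Y\nabla_X-\nabla_{[X,Y]}$; it is properly biharmonic of index $k$ if moreover it is not harmonic. Then: 1. $M$ is properly biharmonic of index $m(1-|H|^2)$ in $\mathbb{S}^n$, i.e. its inclusion $i$ is. 2. If $M$ is connected, then with $a=\frac{1}{\sqrt{1+|H|^2}}$ there is a unit vector $v\in\mathbb{R}^{n+1}$ such that $M$ is contained in the hypersphere $\mathbb{S}_v(a)=\{x\in\mathbb{S}^n : \langle x,v\rangle=\sqrt{1-a^2}\}$ of radius $a$, and $M$ is harmonic (minimal) in it: the inclusion of $M$ in $\mathbb{S}_v(a)$ is a harmonic map. -/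

import Mathlib

open Set
open scoped Manifold ContDiff InnerProductSpace

namespace SubmanifoldGeometry

noncomputable section

/-! ### The target: a submanifold `N` of a Euclidean space

`N` carries the metric induced by the ambient inner product. Its Levi-Civita connection is the
orthogonal projection on `TN` of the derivative of the ambient space. -/

section Target

variable {E : Type*} [NormedAddCommGroup E] [InnerProductSpace ℝ E] [FiniteDimensional ℝ E]

/-- Orthogonal projection of the ambient space on the tangent space `T_x N` (the span of the
tangent cone of `N` at `x`). -/
def tangentProj (N : Set E) (x : E) : E →L[ℝ] E :=
  (Submodule.span ℝ (tangentConeAt ℝ N x)).starProjection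

/-- `(∇_U W)(x)`, the Levi-Civita derivative on `N` of the tangent field `W` along the tangent
field `U`. -/
def covN (N : Set E) (U W : E → E) (x : E) : E :=
  tangentProj N x (fderivWithin ℝ W N x (U x))

/-- The curvature `R(U,V)W = ∇_U ∇_V W - ∇_V ∇_U W - ∇_{[U,V]} W` for tangent fields of `N`
(with `[U,V] = ∇_U V - ∇_V U`). -/
def curvatureField (N : Set E) (U V W : E → E) (x : E) : E :=
  covN N U (covN N V W) x - covN N V (covN N U W) x
    - covN N (fun y => covN N U V y - covN N V U y) W x

/-- The curvature tensor `R_x(u,v)w` of `N`; the tangent vectors `u v w` at `x` are extended to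
tangent fields of `N` by projecting them on the tangent spaces. -/
def curvature (N : Set E) (x u v w : E) : E :=
  curvatureField N (fun y => tangentProj N y u) (fun y => tangentProj N y v)
    (fun y => tangentProj N y w) x

end Target

/-! ### Maps from a Riemannian manifold `(M, g)` to `N`

`g p X Y` is the metric of `M` at `p`; maps to `N` and sections of the pulled back bundle
`φ^* TN` are regarded as functions with values in the ambient space `E`. -/

section Maps

variable {E : Type*} [NormedAddCommGroup E] [InnerProductSpace ℝ E] [FiniteDimensional ℝ E]
  {m : ℕ} {M : Type*} [TopologicalSpace M] [ChartedSpace (EuclideanSpace ℝ (Fin m)) M]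

/-- The `i`-th coordinate vector field `∂_i` of the preferred chart at `p`, at the point `q` of the
domain of that chart. -/
def coordField (p : M) (i : Fin m) (q : M) : TangentSpace (𝓡 m) q :=
  mfderiv (𝓡 m) (𝓡 m) (extChartAt (𝓡 m) p).symm (extChartAt (𝓡 m) p q)
    (EuclideanSpace.single i (1 : ℝ))

variable (g : ∀ p : M, TangentSpace (𝓡 m) p → TangentSpace (𝓡 m) p → ℝ)

/-- The coefficients `g_ij` at `q` of the metric in the preferred chart at `p`. -/
def metricCoeff (p q : M) : Matrix (Fin m) (Fin m) ℝ :=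
  Matrix.of fun i j => g q (coordField p i q) (coordField p j q)

/-- `∂_l g_ij` at `p`, in the preferred chart at `p`. -/
def dMetricCoeff (p : M) (l i j : Fin m) : ℝ :=
  mvfderiv (𝓡 m) (fun q => metricCoeff g p q i j) p (coordField p l p)

/-- The Christoffel symbol `Γ^k_ij` at `p` of the Levi-Civita connection of `g`, in the preferred
chart at `p`. -/
def christoffel (p : M) (k i j : Fin m) : ℝ :=
  (1 / 2) * ∑ l, (metricCoeff g p p)⁻¹ k l *
    (dMetricCoeff g p i j l + dMetricCoeff g p j i l - dMetricCoeff g p l i j)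

/-- The trace `g^ij b(∂_i, ∂_j)` at `p` of a bilinear form with respect to `g`. -/
def metricTrace (p : M) (b : Fin m → Fin m → E) : E :=
  ∑ i, ∑ j, (metricCoeff g p p)⁻¹ i j • b i j

/-- `∇_X V` at `p`, for a section `V` of `φ^* TN` and the pulled back Levi-Civita connection. -/
def covAlong (N : Set E) (φ V : M → E) (p : M) (X : TangentSpace (𝓡 m) p) : E :=
  tangentProj N (φ p) (mvfderiv (𝓡 m) V p X)

/-- `(∇ Tφ)(∂_i, ∂_j) = ∇_{∂_i} (Tφ ∂_j) - Tφ (∇_{∂_i} ∂_j)` at `p`. For an isometric immersion this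
is the second fundamental form. -/
def secondFundamentalForm (N : Set E) (φ : M → E) (p : M) (i j : Fin m) : E :=
  covAlong N φ (fun q => mvfderiv (𝓡 m) φ q (coordField p j q)) p (coordField p i p)
    - ∑ k, christoffel g p k i j • mvfderiv (𝓡 m) φ p (coordField p k p)

/-- `δ Tφ = - tr ∇ Tφ`. -/
def divTangentMap (N : Set E) (φ : M → E) (p : M) : E :=
  - metricTrace g p (secondFundamentalForm g N φ p)

/-- `φ` is a harmonic map from `(M, g)` to `N`. -/
def IsHarmonic (N : Set E) (φ : M → E) : Prop :=
  (∀ p, φ p ∈ N) ∧ ∀ p, divTangentMap g N φ p = 0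

/-- The Laplacian `Δ V = - tr ∇² V` of a section `V` of `φ^* TN`, where
`∇² V (∂_i, ∂_j) = ∇_{∂_i} ∇_{∂_j} V - ∇_{∇_{∂_i} ∂_j} V`. -/
def roughLaplacian (N : Set E) (φ V : M → E) (p : M) : E :=
  - metricTrace g p fun i j =>
      covAlong N φ (fun q => covAlong N φ V q (coordField p j q)) p (coordField p i p)
        - ∑ k, christoffel g p k i j • covAlong N φ V p (coordField p k p)

/-- `S(V) = tr R(V, Tφ) Tφ`, with `R` the curvature of `N`. -/
def curvatureTerm (N : Set E) (φ V : M → E) (p : M) : E :=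
  metricTrace g p fun i j =>
    curvature N (φ p) (V p) (mvfderiv (𝓡 m) φ p (coordField p i p))
      (mvfderiv (𝓡 m) φ p (coordField p j p))

/-- `φ` is a biharmonic map of index `k` from `(M, g)` to `N`:
`Δ δTφ - S(δTφ) + k δTφ = 0`. -/
def IsBiharmonicOfIndex (N : Set E) (φ : M → E) (k : ℝ) : Prop :=
  (∀ p, φ p ∈ N) ∧ ∀ p,
    roughLaplacian g N φ (divTangentMap g N φ) p - curvatureTerm g N φ (divTangentMap g N φ) p
      + k • divTangentMap g N φ p = 0

/-- `φ` is properly biharmonic of index `k`: biharmonic of index `k` and not harmonic. -/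
def IsProperlyBiharmonicOfIndex (N : Set E) (φ : M → E) (k : ℝ) : Prop :=
  IsBiharmonicOfIndex g N φ k ∧ ¬ IsHarmonic g N φ

end Maps

/-! ### Submanifolds

A submanifold `M` of `N` is given by its inclusion `f`, and carries the induced metric. `TM` is
regarded as a subbundle of `f^* TN` by means of `Tf`. -/

section Submanifold

variable {E : Type*} [NormedAddCommGroup E] [InnerProductSpace ℝ E] [FiniteDimensional ℝ E]
  {m : ℕ} {M : Type*} [TopologicalSpace M] [ChartedSpace (EuclideanSpace ℝ (Fin m)) M]

variable (m) in
/-- The metric of `M` induced by `f`. -/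
def inducedMetric (f : M → E) (p : M) (X Y : TangentSpace (𝓡 m) p) : ℝ :=
  ⟪mvfderiv (𝓡 m) f p X, mvfderiv (𝓡 m) f p Y⟫_ℝ

variable (m) in
/-- The mean curvature `H = (1/m) tr B` of `M` in `N`. -/
def meanCurvature (N : Set E) (f : M → E) (p : M) : E :=
  (1 / (m : ℝ)) • metricTrace (inducedMetric m f) p (secondFundamentalForm (inducedMetric m f) N f p)

variable (m) in
/-- Orthogonal projection of the ambient space on `Tf (T_p M)`. -/
def tangentPart (f : M → E) (p : M) : E →L[ℝ] E :=
  (LinearMap.range (mvfderiv (𝓡 m) f p).toLinearMap).starProjection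

/-- The Weingarten operator: `A_ξ X = - (∇_X ξ)^T`, for a normal field `ξ` of `M` in `N`. -/
def weingarten (N : Set E) (f ξ : M → E) (p : M) (X : TangentSpace (𝓡 m) p) : E :=
  - tangentPart m f p (covAlong N f ξ p X)

/-- The normal connection `∇^N_X ξ = (∇_X ξ)^⊥`, for a normal field `ξ` of `M` in `N`. -/
def normalCov (N : Set E) (f ξ : M → E) (p : M) (X : TangentSpace (𝓡 m) p) : E :=
  covAlong N f ξ p X - tangentPart m f p (covAlong N f ξ p X)

variable (m) in
/-- `A_H = |H|² Id`. -/
def IsPseudoUmbilical (N : Set E) (f : M → E) : Prop :=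
  ∀ (p : M) (X : TangentSpace (𝓡 m) p),
    weingarten N f (meanCurvature m N f) p X = ‖meanCurvature m N f p‖ ^ 2 • mvfderiv (𝓡 m) f p X

variable (m) in
/-- `∇^N H = 0`. -/
def HasParallelMeanCurvature (N : Set E) (f : M → E) : Prop :=
  ∀ (p : M) (X : TangentSpace (𝓡 m) p), normalCov N f (meanCurvature m N f) p X = 0

end Submanifold

/-- The hypersphere `S(a)` of radius `a ∈ (0,1]` of the unit sphere, with axis the unit vector
`v`. -/
def hypersphere {E : Type*} [NormedAddCommGroup E] [InnerProductSpace ℝ E] (v : E) (a : ℝ) :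
    Set E :=
  {x | x ∈ Metric.sphere (0 : E) 1 ∧ ⟪x, v⟫_ℝ = √(1 - a ^ 2)}

end

end SubmanifoldGeometry

namespace SubmanifoldGeometry

/-! ### Tangent spaces and orthogonal projections of subsets of a Euclidean space -/

section TangentSpaces

variable {E : Type*} [NormedAddCommGroup E] [InnerProductSpace ℝ E]

/-! Everything follows from one identity in the ambient space: $dH = -h^2\,df$, with $h = |H|$
(`mvfderiv_meanCurvature_sphere`). Parallelism and pseudo-umbilicity give $\nabla_X H = -h^2\,df(X)$
in the sphere, and the radial part of $dH$ vanishes because $\langle H, f\rangle = 0$ and $H$ is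
normal to $M$.

Biharmonicity: $\delta Tf = -mH$, so $\nabla(\delta Tf) = mh^2\,df$. A second derivative and a trace
give $\Delta\,\delta Tf = mh^2\,\delta Tf$. Constant curvature 1 (`curvature_sphere`) and
$\operatorname{tr} g = m$ give $S(\delta Tf) = m\,\delta Tf$. The equation becomes $(mh^2 - m +
k)\,\delta Tf = 0$, whence $k = m(1-h^2)$; the map is not harmonic because $H \ne 0$.

Reduction: $w = H + h^2 f$ has zero derivative, so it is constant on a connected $M$. From $\langle
f, w\rangle = h^2$ and $|w| = h\sqrt{1+h^2}$, $f$ lies in the hypersphere with axis $w/|w|$. The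
tension field there is the projection of $mH$ (`divTangentMap_eq`), and $H = w - h^2 f$ is
orthogonal to that hypersphere's tangent spaces. -/

theorem map_mem_tangentConeAt {V : Type*} [NormedAddCommGroup V] [NormedSpace ℝ V] {N : Set E}
    {F : V → E} {F' : V →L[ℝ] E} {y : V} (hF : HasFDerivAt F F' y) (hN : ∀ z, F z ∈ N) (v : V) :
    F' v ∈ tangentConeAt ℝ N (F y) := by
  have h := hF.hasFDerivWithinAt (s := univ) |>.mapsTo_tangent_cone
  rw [tangentConeAt_univ] at h
  exact tangentConeAt_mono (by rintro _ ⟨z, -, rfl⟩; exact hN z) (h (mem_univ v))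

/-- Both `F'` and 0 are derivatives of `F` within `N`, and such derivatives agree on the span of the
tangent cone. Hence tangent vectors are orthogonal to gradients of functions constant on `N`. -/
theorem apply_eq_zero_of_mem_span_tangentConeAt {N : Set E} {F : E → ℝ} {F' : E →L[ℝ] ℝ} {x : E}
    {c : ℝ} (hF : HasFDerivAt F F' x) (hc : ∀ z ∈ N, F z = c) (hx : x ∈ N) {u : E}
    (hu : u ∈ Submodule.span ℝ (tangentConeAt ℝ N x)) : F' u = 0 := by
  have h0 : HasFDerivWithinAt F (0 : E →L[ℝ] ℝ) N x :=
    (hasFDerivWithinAt_const c x N).congr hc (hc x hx)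
  exact LinearMap.eqOn_span' (f := F'.toLinearMap) (g := 0)
    (hF.hasFDerivWithinAt.unique_on h0) hu

theorem mem_span_tangentConeAt_sphere {x u : E} (hx : ‖x‖ = 1) (hu : ⟪x, u⟫_ℝ = 0) :
    u ∈ Submodule.span ℝ (tangentConeAt ℝ (Metric.sphere (0 : E) 1) x) := by
  rcases eq_or_ne u 0 with rfl | hu0
  · exact Submodule.zero_mem _
  set w : E := ‖u‖⁻¹ • u with hw
  have hwn : ‖w‖ = 1 := by simp [hw, norm_smul, hu0]
  have hxw : ⟪x, w⟫_ℝ = 0 := by simp [hw, inner_smul_right, hu]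
  -- The great circle through `x` with velocity `w` realises `w` as a tangent vector.
  have hd : HasDerivAt (fun t : ℝ => Real.cos t • x + Real.sin t • w) w 0 := by
    simpa using ((Real.hasDerivAt_cos 0).smul_const x).fun_add ((Real.hasDerivAt_sin 0).smul_const w)
  have hN : ∀ t : ℝ, Real.cos t • x + Real.sin t • w ∈ Metric.sphere (0 : E) 1 := by
    intro t
    have : ‖Real.cos t • x + Real.sin t • w‖ ^ 2 = 1 := by
      rw [norm_add_sq_real, norm_smul, norm_smul, hx, hwn, inner_smul_left, inner_smul_right, hxw]
      simp
    simpa [pow_eq_one_iff_of_nonneg] using this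
  have h := map_mem_tangentConeAt hd.hasFDerivAt hN 1
  simp only [Real.cos_zero, Real.sin_zero, one_smul, zero_smul, add_zero,
    ContinuousLinearMap.toSpanSingleton_apply] at h
  have hu' : u = ‖u‖ • w := by simp [hw, smul_smul, hu0]
  rw [hu']
  exact Submodule.smul_mem _ _ (Submodule.subset_span h)

theorem inner_eq_zero_of_mem_span_tangentConeAt {N : Set E} (hN : N ⊆ Metric.sphere (0 : E) 1)
    {x u : E} (hx : x ∈ N) (hu : u ∈ Submodule.span ℝ (tangentConeAt ℝ N x)) : ⟪x, u⟫_ℝ = 0 := by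
  have h := apply_eq_zero_of_mem_span_tangentConeAt (c := 1)
    (hasStrictFDerivAt_norm_sq x).hasFDerivAt (fun z hz => by simp [mem_sphere_zero_iff_norm.1 (hN hz)])
    hx hu
  simpa using h

variable [FiniteDimensional ℝ E]

theorem tangentProj_of_mem {N : Set E} {x u : E}
    (hu : u ∈ Submodule.span ℝ (tangentConeAt ℝ N x)) : tangentProj N x u = u :=
  Submodule.starProjection_eq_self_iff.2 hu

theorem tangentProj_mem (N : Set E) (x u : E) :
    tangentProj N x u ∈ Submodule.span ℝ (tangentConeAt ℝ N x) :=
  Submodule.starProjection_apply_mem _ _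

theorem tangentProj_of_orthogonal {N : Set E} {x u : E}
    (hu : ∀ w ∈ Submodule.span ℝ (tangentConeAt ℝ N x), ⟪w, u⟫_ℝ = 0) : tangentProj N x u = 0 :=
  (Submodule.starProjection_apply_eq_zero_iff _).2 ((Submodule.mem_orthogonal _ _).2 hu)

theorem tangentProj_tangentProj_of_subset {N N' : Set E} (h : N ⊆ N') (x u : E) :
    tangentProj N x (tangentProj N' x u) = tangentProj N x u := by
  rw [← sub_eq_zero, ← map_sub]
  refine tangentProj_of_orthogonal fun w hw => ?_
  have hw' := Submodule.span_mono (tangentConeAt_mono (𝕜 := ℝ) (x := x) h) hw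
  have := (Submodule.mem_orthogonal _ _).1
    (Submodule.sub_starProjection_mem_orthogonal
      (K := Submodule.span ℝ (tangentConeAt ℝ N' x)) u) w hw'
  rw [← neg_sub, inner_neg_right, tangentProj, this, neg_zero]

theorem tangentProj_sphere {x : E} (hx : ‖x‖ = 1) (u : E) :
    tangentProj (Metric.sphere (0 : E) 1) x u = u - ⟪u, x⟫_ℝ • x := by
  have h1 : tangentProj (Metric.sphere (0 : E) 1) x (u - ⟪u, x⟫_ℝ • x) = u - ⟪u, x⟫_ℝ • x := by
    refine tangentProj_of_mem (mem_span_tangentConeAt_sphere hx ?_)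
    simp [inner_sub_right, inner_smul_right, hx, real_inner_comm]
  have h2 : tangentProj (Metric.sphere (0 : E) 1) x x = 0 :=
    tangentProj_of_orthogonal fun w hw => by
      rw [real_inner_comm]
      exact inner_eq_zero_of_mem_span_tangentConeAt subset_rfl (by simpa using hx) hw
  rw [map_sub, map_smul, h2, smul_zero, sub_zero] at h1
  exact h1

end TangentSpaces

/-! ### Curvature of the unit sphere -/

section SphereCurvature

variable {E : Type*} [NormedAddCommGroup E] [InnerProductSpace ℝ E] [FiniteDimensional ℝ E]

/-- Along tangent directions the derivative within `N` is unique, so any differentiable ambient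
extension of `W` computes it. -/
theorem covN_eq_of_hasFDerivAt {N : Set E} {U W F : E → E} {F' : E →L[ℝ] E} {x : E} (hx : x ∈ N)
    (hF : HasFDerivAt F F' x) (hW : EqOn W F N)
    (hU : U x ∈ Submodule.span ℝ (tangentConeAt ℝ N x)) :
    covN N U W x = tangentProj N x (F' (U x)) := by
  have h : HasFDerivWithinAt W F' N x := hF.hasFDerivWithinAt.congr hW (hW hx)
  rw [covN]
  congr 1
  exact LinearMap.eqOn_span' (f := (fderivWithin ℝ W N x).toLinearMap) (g := F'.toLinearMap)
    (h.differentiableWithinAt.hasFDerivWithinAt.unique_on h) hU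

theorem covN_sphere_tangentProj {U : E → E} {x : E} (hx : ‖x‖ = 1) (hU : ⟪x, U x⟫_ℝ = 0) (w : E) :
    covN (Metric.sphere (0 : E) 1) U (fun y => tangentProj (Metric.sphere (0 : E) 1) y w) x
      = -⟪w, x⟫_ℝ • U x := by
  have hF : HasFDerivAt (fun y : E => w - ⟪w, y⟫_ℝ • y) _ x :=
    (((innerSL ℝ w).hasFDerivAt (x := x)).smul (hasFDerivAt_id x)).const_sub w
  rw [covN_eq_of_hasFDerivAt (by simpa using hx) hF
    (fun y hy => tangentProj_sphere (by simpa using hy) w) (mem_span_tangentConeAt_sphere hx hU),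
    tangentProj_sphere hx]
  simp [inner_add_left, inner_smul_left, hx, real_inner_comm x (U x), hU, inner_neg_left]

theorem covN_sphere_covN_sphere {U : E → E} {x v w : E} (hx : ‖x‖ = 1) (hU : ⟪x, U x⟫_ℝ = 0)
    (hv : ⟪x, v⟫_ℝ = 0) (hw : ⟪x, w⟫_ℝ = 0) :
    covN (Metric.sphere (0 : E) 1) U (covN (Metric.sphere (0 : E) 1)
      (fun y => tangentProj (Metric.sphere (0 : E) 1) y v)
      (fun y => tangentProj (Metric.sphere (0 : E) 1) y w)) x = -⟪w, U x⟫_ℝ • v := by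
  have hF : HasFDerivAt (fun y : E => -⟪w, y⟫_ℝ • (v - ⟪v, y⟫_ℝ • y)) _ x :=
    ((innerSL ℝ w).hasFDerivAt (x := x)).neg.smul
      ((((innerSL ℝ v).hasFDerivAt (x := x)).smul (hasFDerivAt_id x)).const_sub v)
  have hW : EqOn (covN (Metric.sphere (0 : E) 1)
      (fun y => tangentProj (Metric.sphere (0 : E) 1) y v)
      (fun y => tangentProj (Metric.sphere (0 : E) 1) y w))
      (fun y : E => -⟪w, y⟫_ℝ • (v - ⟪v, y⟫_ℝ • y)) (Metric.sphere (0 : E) 1) := by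
    intro y hy
    rw [covN_sphere_tangentProj (U := fun y => tangentProj (Metric.sphere (0 : E) 1) y v)
      (by simpa using hy) (inner_eq_zero_of_mem_span_tangentConeAt
      subset_rfl hy (tangentProj_mem _ _ _)), tangentProj_sphere (by simpa using hy)]
  rw [covN_eq_of_hasFDerivAt (by simpa using hx) hF hW (mem_span_tangentConeAt_sphere hx hU),
    tangentProj_sphere hx]
  have hv' := real_inner_comm x v ▸ hv
  have hw' := real_inner_comm x w ▸ hw
  simp [inner_smul_left, hv', hw', inner_neg_left]

theorem curvature_sphere {x u v w : E} (hx : ‖x‖ = 1) (hu : ⟪x, u⟫_ℝ = 0) (hv : ⟪x, v⟫_ℝ = 0)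
    (hw : ⟪x, w⟫_ℝ = 0) :
    curvature (Metric.sphere (0 : E) 1) x u v w = ⟪v, w⟫_ℝ • u - ⟪u, w⟫_ℝ • v := by
  have hp : ∀ {t : E}, ⟪x, t⟫_ℝ = 0 → tangentProj (Metric.sphere (0 : E) 1) x t = t := fun ht =>
    tangentProj_of_mem (mem_span_tangentConeAt_sphere hx ht)
  have hv' := real_inner_comm x v ▸ hv
  have hu' := real_inner_comm x u ▸ hu
  -- The projected extensions of `u` and `v` have vanishing covariant derivatives at `x`, so their
  -- bracket vanishes there and the third curvature term drops out.
  have h0 : covN (Metric.sphere (0 : E) 1) (fun y => tangentProj (Metric.sphere (0 : E) 1) y u)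
        (fun y => tangentProj (Metric.sphere (0 : E) 1) y v) x
      - covN (Metric.sphere (0 : E) 1) (fun y => tangentProj (Metric.sphere (0 : E) 1) y v)
        (fun y => tangentProj (Metric.sphere (0 : E) 1) y u) x = 0 := by
    rw [covN_sphere_tangentProj hx (by simp only [hp hu, hu]),
      covN_sphere_tangentProj hx (by simp only [hp hv, hv]), hv', hu']
    simp
  rw [curvature, curvatureField, covN_sphere_covN_sphere hx (by simp only [hp hu, hu]) hv hw,
    covN_sphere_covN_sphere hx (by simp only [hp hv, hv]) hu hw,
    covN_sphere_tangentProj hx (by simp only [h0, inner_zero_right]), h0]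
  simp only [hp hu, hp hv, smul_zero, sub_zero]
  rw [real_inner_comm w u, real_inner_comm w v]
  module

end SphereCurvature

/-! ### Derivatives of vector-valued maps in charts -/

section Charts

variable {E : Type*} [NormedAddCommGroup E] [InnerProductSpace ℝ E]
  {m : ℕ} {M : Type*} [TopologicalSpace M] [ChartedSpace (EuclideanSpace ℝ (Fin m)) M]

theorem hasFDerivAt_comp_extChartAt_symm {V : M → E} {p : M}
    (hV : MDifferentiableAt (𝓡 m) 𝓘(ℝ, E) V p) :
    HasFDerivAt (F := E) (E := EuclideanSpace ℝ (Fin m)) (V ∘ (extChartAt (𝓡 m) p).symm)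
      (mvfderiv (𝓡 m) V p) (extChartAt (𝓡 m) p p) := by
  have h := hV.hasMFDerivAt.2
  rw [ModelWithCorners.Boundaryless.range_eq_univ] at h
  have h' : HasFDerivWithinAt (F := E) (E := EuclideanSpace ℝ (Fin m))
    (V ∘ (extChartAt (𝓡 m) p).symm) (mvfderiv (𝓡 m) V p) univ (extChartAt (𝓡 m) p p) := h
  exact hasFDerivWithinAt_univ.1 h'

theorem mvfderiv_eq_zero_of_not_mdifferentiableAt {V : M → E} {p : M}
    (hV : ¬ MDifferentiableAt (𝓡 m) 𝓘(ℝ, E) V p) : mvfderiv (𝓡 m) V p = 0 := by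
  rw [mvfderiv, mfderiv_zero_of_not_mdifferentiableAt hV]
  ext; rfl

/-- Both sides are 0 by default when `V` is not differentiable, so a constant can be pulled out of a
second derivative without checking differentiability. -/
theorem mvfderiv_const_smul (c : ℝ) (V : M → E) (p : M) :
    mvfderiv (𝓡 m) (fun q => c • V q) p = c • mvfderiv (𝓡 m) V p := by
  rcases eq_or_ne c 0 with rfl | hc
  · simp [mvfderiv_const]
  by_cases hV : MDifferentiableAt (𝓡 m) 𝓘(ℝ, E) V p
  · have h := mvfderiv_fun_smul (a := fun _ : M => c) mdifferentiableAt_const hV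
    rw [h, mvfderiv_const]
    ext; simp
  · rw [mvfderiv_eq_zero_of_not_mdifferentiableAt hV, mvfderiv_eq_zero_of_not_mdifferentiableAt,
      smul_zero]
    intro h
    have h' : MDifferentiableAt (𝓡 m) 𝓘(ℝ, E) (fun q => c⁻¹ • c • V q) p := h.const_smul c⁻¹
    simp only [inv_smul_smul₀ hc] at h'
    exact hV h'

theorem mvfderiv_mem_tangentConeAt {N : Set E} {f : M → E} (hN : ∀ q, f q ∈ N) {p : M}
    (hf : MDifferentiableAt (𝓡 m) 𝓘(ℝ, E) f p) (X : TangentSpace (𝓡 m) p) :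
    mvfderiv (𝓡 m) f p X ∈ tangentConeAt ℝ N (f p) := by
  -- The inverse chart is a total function and `f` maps all of `M` into `N`, so no restriction to
  -- the chart target is needed.
  have h := map_mem_tangentConeAt (hasFDerivAt_comp_extChartAt_symm hf)
    (fun z => hN _) X
  simpa only [Function.comp_apply, extChartAt_to_inv] using! h

theorem inner_mvfderiv_add_eq_zero {V W : M → E} {c : ℝ} (hc : ∀ q, ⟪V q, W q⟫_ℝ = c) {p : M}
    (hV : MDifferentiableAt (𝓡 m) 𝓘(ℝ, E) V p) (hW : MDifferentiableAt (𝓡 m) 𝓘(ℝ, E) W p)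
    (X : TangentSpace (𝓡 m) p) :
    ⟪V p, mvfderiv (𝓡 m) W p X⟫_ℝ + ⟪mvfderiv (𝓡 m) V p X, W p⟫_ℝ = 0 := by
  have key : ∀ A B : EuclideanSpace ℝ (Fin m) →L[ℝ] E,
      HasFDerivAt (V ∘ (extChartAt (𝓡 m) p).symm) A (extChartAt (𝓡 m) p p) →
      HasFDerivAt (W ∘ (extChartAt (𝓡 m) p).symm) B (extChartAt (𝓡 m) p p) →
      ∀ Y, ⟪V p, B Y⟫_ℝ + ⟪A Y, W p⟫_ℝ = 0 := by
    intro A B hA hB Y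
    have h := hA.inner ℝ hB
    simp only [Function.comp_apply, hc] at h
    simpa using DFunLike.congr_fun (h.unique (hasFDerivAt_const c _)) Y
  exact key _ _ (hasFDerivAt_comp_extChartAt_symm hV) (hasFDerivAt_comp_extChartAt_symm hW) X

theorem isLocallyConstant_of_mvfderiv_eq_zero [IsManifold (𝓡 m) 1 M] {V : M → E}
    (hV : MDifferentiable (𝓡 m) 𝓘(ℝ, E) V) (h0 : ∀ p, mvfderiv (𝓡 m) V p = 0) :
    IsLocallyConstant V := by
  rw [IsLocallyConstant.iff_eventually_eq]
  intro p
  set e := extChartAt (𝓡 m) p with he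
  have hd : ∀ y ∈ e.target, HasFDerivAt (V ∘ e.symm) (0 : EuclideanSpace ℝ (Fin m) →L[ℝ] E) y := by
    intro y hy
    have hs : MDifferentiableAt 𝓘(ℝ, EuclideanSpace ℝ (Fin m)) (𝓡 m) e.symm y := by
      have := mdifferentiableWithinAt_extChartAt_symm (I := 𝓡 m) hy
      rwa [ModelWithCorners.Boundaryless.range_eq_univ, mdifferentiableWithinAt_univ] at this
    have h0' : mfderiv (𝓡 m) 𝓘(ℝ, E) V (e.symm y) = 0 := h0 (e.symm y)
    have hc := HasMFDerivAt.comp y (hV (e.symm y)).hasMFDerivAt hs.hasMFDerivAt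
    rw [h0'] at hc
    exact hc.hasFDerivAt.congr_fderiv (ContinuousLinearMap.zero_comp _)
  obtain ⟨r, hr, hball⟩ := Metric.isOpen_iff.1 (isOpen_extChartAt_target (I := 𝓡 m) p) (e p)
    (mem_extChartAt_target p)
  have hconst : ∀ y ∈ Metric.ball (e p) r, V (e.symm y) = V p := by
    intro y hy
    have := (convex_ball (e p) r).is_const_of_fderivWithin_eq_zero (𝕜 := ℝ) (f := V ∘ e.symm)
      (fun z hz => (hd z (hball hz)).differentiableAt.differentiableWithinAt)
      (fun z hz => by
        rw [fderivWithin_of_isOpen Metric.isOpen_ball hz, (hd z (hball hz)).fderiv])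
      hy (Metric.mem_ball_self hr)
    simpa [he] using this
  filter_upwards [extChartAt_source_mem_nhds (I := 𝓡 m) p,
    (continuousAt_extChartAt (I := 𝓡 m) p).preimage_mem_nhds (Metric.ball_mem_nhds _ hr)] with q hq hq'
  rw [← hconst _ hq', he, (extChartAt (𝓡 m) p).left_inv hq]

theorem coordField_self [IsManifold (𝓡 m) 1 M] (p : M) (i : Fin m) :
    coordField p i p = (EuclideanSpace.single i (1 : ℝ) : EuclideanSpace ℝ (Fin m)) := by
  have h := mfderivWithin_range_extChartAt_symm (I := 𝓡 m) (x := p)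
  rw [ModelWithCorners.Boundaryless.range_eq_univ, mfderivWithin_univ] at h
  exact DFunLike.congr_fun h (EuclideanSpace.single i (1 : ℝ) : EuclideanSpace ℝ (Fin m))

end Charts

/-! ### Traces with respect to the induced metric -/

section MetricTrace

variable {E : Type*} [NormedAddCommGroup E] [InnerProductSpace ℝ E]
  {m : ℕ} {M : Type*} [TopologicalSpace M] [ChartedSpace (EuclideanSpace ℝ (Fin m)) M]

theorem metricTrace_smul (g : ∀ p : M, TangentSpace (𝓡 m) p → TangentSpace (𝓡 m) p → ℝ) (p : M)
    (c : ℝ) (b : Fin m → Fin m → E) :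
    metricTrace g p (fun i j => c • b i j) = c • metricTrace g p b := by
  simp only [metricTrace, Finset.smul_sum, smul_comm c]

theorem map_metricTrace (g : ∀ p : M, TangentSpace (𝓡 m) p → TangentSpace (𝓡 m) p → ℝ) (p : M)
    (L : E →L[ℝ] E) (b : Fin m → Fin m → E) :
    metricTrace g p (fun i j => L (b i j)) = L (metricTrace g p b) := by
  simp only [metricTrace, map_sum, map_smul]

/-- This is $\operatorname{tr}_g g = m$. Injectivity of `df` makes the Gram matrix positive
definite, hence invertible. -/
theorem metricTrace_inducedMetric_smul [IsManifold (𝓡 m) 1 M] {f : M → E} {p : M}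
    (hf : Function.Injective (mvfderiv (𝓡 m) f p)) (v : E) :
    metricTrace (inducedMetric m f) p (fun i j => metricCoeff (inducedMetric m f) p p i j • v)
      = (m : ℝ) • v := by
  set G := metricCoeff (inducedMetric m f) p p with hG
  have hgram : G = Matrix.gram ℝ (fun i => mvfderiv (𝓡 m) f p (coordField p i p)) := rfl
  have hli : LinearIndependent ℝ (fun i => mvfderiv (𝓡 m) f p (coordField p i p)) := by
    have h1 : LinearIndependent ℝ
        (fun i => (EuclideanSpace.single i (1 : ℝ) : EuclideanSpace ℝ (Fin m))) := by
      have h0 := (EuclideanSpace.basisFun (Fin m) ℝ).toBasis.linearIndependent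
      have h3 : ⇑(EuclideanSpace.basisFun (Fin m) ℝ).toBasis
          = fun i => EuclideanSpace.single i (1 : ℝ) := by ext; simp
      rwa [h3] at h0
    have h2 := h1.map' (mvfderiv (𝓡 m) f p).toLinearMap (LinearMap.ker_eq_bot.2 hf)
    simpa only [coordField_self] using! h2
  have hdet : IsUnit G.det := by
    rw [hgram]
    exact (Matrix.posDef_gram_of_linearIndependent hli).det_pos.ne'.isUnit
  have hsymm : ∀ i j, G i j = G j i := fun i j => real_inner_comm _ _
  have htr : ∑ i, ∑ j, G⁻¹ i j * G i j = m := by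
    have h := congrArg Matrix.trace (Matrix.nonsing_inv_mul G hdet)
    rw [Matrix.trace_one, Fintype.card_fin] at h
    rw [← h]
    simp only [Matrix.trace, Matrix.diag, Matrix.mul_apply]
    exact Finset.sum_congr rfl fun i _ => Finset.sum_congr rfl fun j _ => by rw [hsymm i j]
  simp only [metricTrace, ← hG, smul_smul, ← Finset.sum_smul, htr]

end MetricTrace

/-! ### Mean curvature and the two conclusions -/

section SphereSubmanifold

variable {E : Type*} [NormedAddCommGroup E] [InnerProductSpace ℝ E] [FiniteDimensional ℝ E]
  {m : ℕ} {M : Type*} [TopologicalSpace M] [ChartedSpace (EuclideanSpace ℝ (Fin m)) M]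

/-- Projecting first on `TN'` and then on `TN` is projecting on `TN`; the Christoffel term is
already tangent to `N` and depends only on `g`. -/
theorem tangentProj_secondFundamentalForm
    (g : ∀ p : M, TangentSpace (𝓡 m) p → TangentSpace (𝓡 m) p → ℝ) {N N' : Set E} (h : N ⊆ N')
    {f : M → E} (hN : ∀ q, f q ∈ N) {p : M} (hf : MDifferentiableAt (𝓡 m) 𝓘(ℝ, E) f p)
    (i j : Fin m) :
    tangentProj N (f p) (secondFundamentalForm g N' f p i j) = secondFundamentalForm g N f p i j := by
  simp only [secondFundamentalForm, covAlong, map_sub, map_sum, map_smul,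
    tangentProj_tangentProj_of_subset h]
  congr 1
  refine Finset.sum_congr rfl fun k _ => ?_
  rw [tangentProj_of_mem (Submodule.subset_span (mvfderiv_mem_tangentConeAt hN hf _))]

theorem divTangentMap_eq {N N' : Set E} (h : N ⊆ N') {f : M → E} (hN : ∀ q, f q ∈ N) (hm : m ≠ 0)
    {p : M} (hf : MDifferentiableAt (𝓡 m) 𝓘(ℝ, E) f p) :
    divTangentMap (inducedMetric m f) N f p
      = -(m : ℝ) • tangentProj N (f p) (meanCurvature m N' f p) := by
  have h1 : secondFundamentalForm (inducedMetric m f) N f p = fun i j =>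
      tangentProj N (f p) (secondFundamentalForm (inducedMetric m f) N' f p i j) := by
    ext1 i; ext1 j
    exact (tangentProj_secondFundamentalForm _ h hN hf i j).symm
  rw [divTangentMap, h1, map_metricTrace, meanCurvature, map_smul, smul_smul]
  field_simp
  simp

theorem meanCurvature_mem_span_tangentConeAt {N : Set E} {f : M → E} (hN : ∀ q, f q ∈ N)
    {p : M} (hf : MDifferentiableAt (𝓡 m) 𝓘(ℝ, E) f p) :
    meanCurvature m N f p ∈ Submodule.span ℝ (tangentConeAt ℝ N (f p)) := by
  have h1 : secondFundamentalForm (inducedMetric m f) N f p = fun i j =>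
      tangentProj N (f p) (secondFundamentalForm (inducedMetric m f) N f p i j) := by
    ext1 i; ext1 j
    exact (tangentProj_secondFundamentalForm _ subset_rfl hN hf i j).symm
  rw [meanCurvature, h1, map_metricTrace]
  exact Submodule.smul_mem _ _ (tangentProj_mem _ _ _)

theorem divTangentMap_eq_meanCurvature {N : Set E} {f : M → E} (hN : ∀ q, f q ∈ N) (hm : m ≠ 0)
    {p : M} (hf : MDifferentiableAt (𝓡 m) 𝓘(ℝ, E) f p) :
    divTangentMap (inducedMetric m f) N f p = -(m : ℝ) • meanCurvature m N f p := by
  rw [divTangentMap_eq subset_rfl hN hm hf,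
    tangentProj_of_mem (meanCurvature_mem_span_tangentConeAt hN hf)]

theorem dimension_ne_zero_of_meanCurvature_ne_zero {N : Set E} {f : M → E} {p : M}
    (hH : meanCurvature m N f p ≠ 0) : m ≠ 0 := by
  rintro rfl
  simp [meanCurvature] at hH

/-- Parallelism leaves only the tangential part of $\nabla_X H$, which pseudo-umbilicity prescribes.
-/
theorem covAlong_meanCurvature {N : Set E} {f : M → E} (h_umb : IsPseudoUmbilical m N f)
    (h_par : HasParallelMeanCurvature m N f) (p : M) (X : TangentSpace (𝓡 m) p) :
    covAlong N f (meanCurvature m N f) p X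
      = -‖meanCurvature m N f p‖ ^ 2 • mvfderiv (𝓡 m) f p X := by
  have h1 := h_umb p X
  have h2 := h_par p X
  rw [normalCov, sub_eq_zero] at h2
  rw [weingarten, ← h2] at h1
  rw [neg_smul, ← h1, neg_neg]

/-- Where $H$ failed to be differentiable its derivative would be 0 by default, whereas $\nabla_X H
= -|H|^2\,df(X)$ is nonzero for $X \ne 0$. This replaces a smoothness argument through the metric
coefficients. -/
theorem mdifferentiable_meanCurvature {N : Set E} {f : M → E}
    (hf_imm : ∀ p, Function.Injective (mvfderiv (𝓡 m) f p)) (h_umb : IsPseudoUmbilical m N f)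
    (h_par : HasParallelMeanCurvature m N f) (hH : ∀ p, meanCurvature m N f p ≠ 0) :
    MDifferentiable (𝓡 m) 𝓘(ℝ, E) (meanCurvature m N f) := by
  intro p
  by_contra hd
  have hm := dimension_ne_zero_of_meanCurvature_ne_zero (hH p)
  obtain ⟨X, hX⟩ : ∃ X : TangentSpace (𝓡 m) p, X ≠ 0 := by
    refine ⟨(EuclideanSpace.single ⟨0, Nat.pos_of_ne_zero hm⟩ (1 : ℝ) : EuclideanSpace ℝ (Fin m)),
      fun h0 => ?_⟩
    have h1 : (EuclideanSpace.single ⟨0, Nat.pos_of_ne_zero hm⟩ (1 : ℝ) :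
      EuclideanSpace ℝ (Fin m)) = 0 := h0
    simp at h1
  have h0 := covAlong_meanCurvature h_umb h_par p X
  rw [covAlong, mvfderiv_eq_zero_of_not_mdifferentiableAt hd, zero_apply, map_zero, eq_comm,
    smul_eq_zero] at h0
  rcases h0 with h0 | h0
  · simp [hH p] at h0
  · exact hX (hf_imm p (h0.trans (map_zero _).symm))

variable {f : M → E} {h : ℝ}

theorem mvfderiv_meanCurvature_sphere (hf : MDifferentiable (𝓡 m) 𝓘(ℝ, E) f)
    (hf_imm : ∀ p, Function.Injective (mvfderiv (𝓡 m) f p))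
    (hf_sphere : ∀ p, f p ∈ Metric.sphere (0 : E) 1)
    (h_umb : IsPseudoUmbilical m (Metric.sphere 0 1) f)
    (h_par : HasParallelMeanCurvature m (Metric.sphere 0 1) f) (h_ne : h ≠ 0)
    (h_norm : ∀ p, ‖meanCurvature m (Metric.sphere 0 1) f p‖ = h) (p : M)
    (X : TangentSpace (𝓡 m) p) :
    ⟪meanCurvature m (Metric.sphere 0 1) f p, mvfderiv (𝓡 m) f p X⟫_ℝ = 0 ∧
    mvfderiv (𝓡 m) (meanCurvature m (Metric.sphere 0 1) f) p X = -h ^ 2 • mvfderiv (𝓡 m) f p X := by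
  set H := meanCurvature m (Metric.sphere (0 : E) 1) f with hHdef
  have hH : ∀ p, H p ≠ 0 := fun p => norm_ne_zero_iff.1 (by rw [h_norm]; exact h_ne)
  have hd := mdifferentiable_meanCurvature hf_imm h_umb h_par hH
  have hHf : ∀ q, ⟪H q, f q⟫_ℝ = 0 := fun q => by
    rw [real_inner_comm]
    exact inner_eq_zero_of_mem_span_tangentConeAt subset_rfl (hf_sphere q)
      (meanCurvature_mem_span_tangentConeAt hf_sphere (hf q))
  have h1 := inner_mvfderiv_add_eq_zero hHf (hd p) (hf p) X
  have h2 := inner_mvfderiv_add_eq_zero (c := h ^ 2)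
    (fun q => by rw [real_inner_self_eq_norm_sq, h_norm]) (hd p) (hd p) X
  have h3 := covAlong_meanCurvature h_umb h_par p X
  rw [covAlong, tangentProj_sphere (by simpa using hf_sphere p), ← hHdef, h_norm, sub_eq_iff_eq_add]
    at h3
  -- Normality of $H$ is obtained without the Koszul formula: constancy of $|H|$ gives $\langle H,
  -- dH(X)\rangle = 0$, and $dH(X)$ is $-h^2\,df(X)$ plus a multiple of $f$, which is orthogonal to
  -- $H$.
  have h4 : ⟪H p, mvfderiv (𝓡 m) f p X⟫_ℝ = 0 := by
    rw [real_inner_comm (H p), ← two_mul] at h2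
    have h5 : ⟪H p, mvfderiv (𝓡 m) H p X⟫_ℝ = 0 := by linarith
    rw [h3, inner_add_right, inner_smul_right, inner_smul_right, hHf, mul_zero, add_zero] at h5
    exact (mul_eq_zero.1 h5).resolve_left (by simpa using h_ne)
  refine ⟨h4, ?_⟩
  have h6 : ⟪mvfderiv (𝓡 m) H p X, f p⟫_ℝ = 0 := by linarith
  rw [h3, h6, zero_smul, add_zero]

theorem metricTrace_secondFundamentalForm {N : Set E} (hm : m ≠ 0) (p : M) :
    metricTrace (inducedMetric m f) p (secondFundamentalForm (inducedMetric m f) N f p)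
      = (m : ℝ) • meanCurvature m N f p := by
  rw [meanCurvature, smul_smul]
  field_simp
  simp

theorem isProperlyBiharmonicOfIndex_sphere [IsManifold (𝓡 m) 1 M] [Nonempty M]
    (hf : MDifferentiable (𝓡 m) 𝓘(ℝ, E) f)
    (hf_imm : ∀ p, Function.Injective (mvfderiv (𝓡 m) f p))
    (hf_sphere : ∀ p, f p ∈ Metric.sphere (0 : E) 1)
    (h_umb : IsPseudoUmbilical m (Metric.sphere 0 1) f)
    (h_par : HasParallelMeanCurvature m (Metric.sphere 0 1) f) (h_ne : h ≠ 0)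
    (h_norm : ∀ p, ‖meanCurvature m (Metric.sphere 0 1) f p‖ = h) :
    IsProperlyBiharmonicOfIndex (inducedMetric m f) (Metric.sphere 0 1) f (m * (1 - h ^ 2)) := by
  set H := meanCurvature m (Metric.sphere (0 : E) 1) f with hHdef
  have hH : ∀ p, H p ≠ 0 := fun p => norm_ne_zero_iff.1 (by rw [h_norm]; exact h_ne)
  have hm : m ≠ 0 := dimension_ne_zero_of_meanCurvature_ne_zero (hH (Classical.arbitrary M))
  have hdH := mvfderiv_meanCurvature_sphere hf hf_imm hf_sphere h_umb h_par h_ne h_norm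
  have hδ : divTangentMap (inducedMetric m f) (Metric.sphere 0 1) f = fun q => -(m : ℝ) • H q :=
    funext fun q => divTangentMap_eq_meanCurvature hf_sphere hm (hf q)
  refine ⟨⟨hf_sphere, fun p => ?_⟩, fun hharm => ?_⟩
  · have hcov : ∀ q (X : TangentSpace (𝓡 m) q), covAlong (Metric.sphere 0 1) f
        (fun q => -(m : ℝ) • H q) q X = ((m : ℝ) * h ^ 2) • mvfderiv (𝓡 m) f q X := fun q X => by
      rw [covAlong, mvfderiv_const_smul, smul_apply, (hdH q X).2, map_smul, map_smul,
        tangentProj_of_mem (Submodule.subset_span (mvfderiv_mem_tangentConeAt hf_sphere (hf q) X))]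
      module
    -- By `hcov`, the second covariant derivative of $\delta Tf$ is $mh^2$ times the second
    -- fundamental form.
    have hΔ : roughLaplacian (inducedMetric m f) (Metric.sphere 0 1) f
        (fun q => -(m : ℝ) • H q) p = -(((m : ℝ) * h ^ 2) • (m : ℝ) • H p) := by
      have htr : (m : ℝ) • H p = _ := (metricTrace_secondFundamentalForm hm p).symm
      rw [roughLaplacian, htr, ← metricTrace_smul]
      congr 2
      ext1 i; ext1 j
      simp only [hcov]
      simp only [secondFundamentalForm, covAlong, smul_sub, Finset.smul_sum]
      rw [mvfderiv_const_smul, smul_apply, map_smul]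
      congr 1
      exact Finset.sum_congr rfl fun k _ => smul_comm _ _ _
    have hS : curvatureTerm (inducedMetric m f) (Metric.sphere 0 1) f
        (fun q => -(m : ℝ) • H q) p = (m : ℝ) • -(m : ℝ) • H p := by
      rw [curvatureTerm, ← metricTrace_inducedMetric_smul (hf_imm p)]
      congr 1
      ext1 i; ext1 j
      have ht : ∀ {u : E}, u ∈ Submodule.span ℝ (tangentConeAt ℝ (Metric.sphere (0 : E) 1) (f p)) →
          ⟪f p, u⟫_ℝ = 0 := inner_eq_zero_of_mem_span_tangentConeAt subset_rfl (hf_sphere p)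
      have hdf := fun X => ht (Submodule.subset_span (mvfderiv_mem_tangentConeAt hf_sphere (hf p) X))
      rw [curvature_sphere (by simpa using hf_sphere p)
        (ht (Submodule.smul_mem _ _ (meanCurvature_mem_span_tangentConeAt hf_sphere (hf p))))
        (hdf _) (hdf _), inner_smul_left, (hdH p _).1, mul_zero, zero_smul, sub_zero]
      rfl
    rw [hδ, hΔ, hS]
    module
  · have h0 := hharm.2 (Classical.arbitrary M)
    rw [hδ] at h0
    simp [hm, hH] at h0

theorem exists_hypersphere_isHarmonic [IsManifold (𝓡 m) 1 M] [Nonempty M] [PreconnectedSpace M]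
    (hf : MDifferentiable (𝓡 m) 𝓘(ℝ, E) f)
    (hf_imm : ∀ p, Function.Injective (mvfderiv (𝓡 m) f p))
    (hf_sphere : ∀ p, f p ∈ Metric.sphere (0 : E) 1)
    (h_umb : IsPseudoUmbilical m (Metric.sphere 0 1) f)
    (h_par : HasParallelMeanCurvature m (Metric.sphere 0 1) f) (h_ne : h ≠ 0)
    (h_norm : ∀ p, ‖meanCurvature m (Metric.sphere 0 1) f p‖ = h) :
    ∃ v : E, ‖v‖ = 1 ∧ (∀ p, f p ∈ hypersphere v (1 / √(1 + h ^ 2))) ∧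
      IsHarmonic (inducedMetric m f) (hypersphere v (1 / √(1 + h ^ 2))) f := by
  set H := meanCurvature m (Metric.sphere (0 : E) 1) f with hHdef
  have hH : ∀ p, H p ≠ 0 := fun p => norm_ne_zero_iff.1 (by rw [h_norm]; exact h_ne)
  have hm : m ≠ 0 := dimension_ne_zero_of_meanCurvature_ne_zero (hH (Classical.arbitrary M))
  -- The sign matters for $\sqrt{1-a^2} = h/\sqrt{1+h^2}$.
  have hpos : 0 < h := (h_norm (Classical.arbitrary M) ▸ norm_nonneg _).lt_of_ne' h_ne
  have hd := mdifferentiable_meanCurvature hf_imm h_umb h_par hH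
  have hdH := mvfderiv_meanCurvature_sphere hf hf_imm hf_sphere h_umb h_par h_ne h_norm
  have hfn : ∀ p, ‖f p‖ = 1 := fun p => by simpa using hf_sphere p
  have hHf : ∀ q, ⟪f q, H q⟫_ℝ = 0 := fun q =>
    inner_eq_zero_of_mem_span_tangentConeAt subset_rfl (hf_sphere q)
      (meanCurvature_mem_span_tangentConeAt hf_sphere (hf q))
  have hd2 : MDifferentiable (𝓡 m) 𝓘(ℝ, E) (fun q => h ^ 2 • f q) := fun q =>
    (hf q).const_smul (h ^ 2)
  have hconst : IsLocallyConstant (fun q => H q + h ^ 2 • f q) := by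
    refine isLocallyConstant_of_mvfderiv_eq_zero (fun q => (hd q).add (hd2 q)) fun q => ?_
    rw [mvfderiv_fun_add (hd q) (hd2 q), mvfderiv_const_smul]
    ext X
    rw [add_apply, smul_apply, (hdH q X).2, neg_smul, neg_add_cancel]
    rfl
  set s := √(1 + h ^ 2) with hs
  have hspos : 0 < s := Real.sqrt_pos.2 (by positivity)
  have hs2 : s ^ 2 = 1 + h ^ 2 := Real.sq_sqrt (by positivity)
  set w := H (Classical.arbitrary M) + h ^ 2 • f (Classical.arbitrary M) with hw
  have hwq : ∀ q, H q + h ^ 2 • f q = w := fun q => hconst.apply_eq_of_preconnectedSpace _ _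
  have hwn : ‖w‖ = h * s := by
    rw [← sq_eq_sq₀ (norm_nonneg _) (by positivity), hw, norm_add_sq_real, inner_smul_right,
      real_inner_comm, hHf, norm_smul, h_norm, hfn, mul_pow h s, hs2]
    simp
    ring
  have hfw : ∀ p, ⟪f p, w⟫_ℝ = h ^ 2 := fun p => by
    rw [← hwq p, inner_add_right, hHf, inner_smul_right, real_inner_self_eq_norm_sq, hfn]
    ring
  have hsq : √(1 - (1 / s) ^ 2) = h / s := by
    rw [Real.sqrt_eq_iff_mul_self_eq_of_pos (by positivity)]
    field_simp
    linarith
  refine ⟨(h * s)⁻¹ • w, ?_, ?_⟩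
  · rw [norm_smul, hwn, norm_inv, Real.norm_of_nonneg (by positivity)]
    exact inv_mul_cancel₀ (by positivity)
  set v := (h * s)⁻¹ • w with hv
  have hmem : ∀ p, f p ∈ hypersphere v (1 / s) := fun p => by
    refine ⟨hf_sphere p, ?_⟩
    rw [hv, inner_smul_right, hfw, hsq]
    field_simp
  refine ⟨hmem, hmem, fun p => ?_⟩
  rw [divTangentMap_eq (N' := Metric.sphere 0 1) (fun x hx => hx.1) hmem hm (hf p),
    tangentProj_of_orthogonal, smul_zero]
  intro u hu
  -- Only one inclusion is needed: tangent vectors of the hypersphere are orthogonal to $f(p)$ and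
  -- to $v$, hence to $H = w - h^2 f$.
  have h1 := inner_eq_zero_of_mem_span_tangentConeAt (fun x hx => hx.1) (hmem p) hu
  have h2 : ⟪v, u⟫_ℝ = 0 := apply_eq_zero_of_mem_span_tangentConeAt
    (innerSL ℝ v).hasFDerivAt (fun z hz => by simpa [real_inner_comm] using hz.2) (hmem p) hu
  rw [hv, real_inner_smul_left] at h2
  have h3 : ⟪w, u⟫_ℝ = 0 := (mul_eq_zero.1 h2).resolve_left (by positivity)
  rw [← hHdef, eq_sub_of_add_eq (hwq p), inner_sub_right, inner_smul_right, real_inner_comm, h3,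
    real_inner_comm, h1]
  simp

end SphereSubmanifold

end SubmanifoldGeometry

theorem mainTheorem2 {m n : ℕ} {M : Type*} [TopologicalSpace M]
    [ChartedSpace (EuclideanSpace ℝ (Fin m)) M] [IsManifold (𝓡 m) ∞ M] [Nonempty M]
    (f : M → EuclideanSpace ℝ (Fin (n + 1)))
    (hf : ContMDiff (𝓡 m) 𝓘(ℝ, EuclideanSpace ℝ (Fin (n + 1))) ∞ f)
    (hf_imm : ∀ p, Function.Injective (mvfderiv (𝓡 m) f p))
    (hf_sphere : ∀ p, f p ∈ Metric.sphere (0 : EuclideanSpace ℝ (Fin (n + 1))) 1)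
    (h_umb : SubmanifoldGeometry.IsPseudoUmbilical m (Metric.sphere 0 1) f)
    (h_par : SubmanifoldGeometry.HasParallelMeanCurvature m (Metric.sphere 0 1) f)
    (h : ℝ) (h_ne : h ≠ 0)
    (h_norm : ∀ p, ‖SubmanifoldGeometry.meanCurvature m (Metric.sphere 0 1) f p‖ = h) :
    SubmanifoldGeometry.IsProperlyBiharmonicOfIndex (SubmanifoldGeometry.inducedMetric m f)
        (Metric.sphere 0 1) f (m * (1 - h ^ 2)) ∧
      (PreconnectedSpace M →
        ∃ v : EuclideanSpace ℝ (Fin (n + 1)), ‖v‖ = 1 ∧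
          (∀ p, f p ∈ SubmanifoldGeometry.hypersphere v (1 / √(1 + h ^ 2))) ∧
          SubmanifoldGeometry.IsHarmonic (SubmanifoldGeometry.inducedMetric m f)
            (SubmanifoldGeometry.hypersphere v (1 / √(1 + h ^ 2))) f) := by
  have : IsManifold (𝓡 m) 1 M := IsManifold.of_le (n := ∞) (by simp)
  have hf' := hf.mdifferentiable (by simp)
  exact ⟨SubmanifoldGeometry.isProperlyBiharmonicOfIndex_sphere hf' hf_imm hf_sphere h_umb h_par
      h_ne h_norm,
    fun _ => SubmanifoldGeometry.exists_hypersphere_isHarmonic hf' hf_imm hf_sphere h_umb h_par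
      h_ne h_norm⟩
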